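/- Let $p,q$ be coprime integers with $0<p<q$, let $\alpha=\frac pq$, and let $\bigl(\frac xr,\frac ys\bigr)$ be the pair of Farey parents of $\alpha$: the unique pair of irreducible fractions with $r,s\ge 0$ (and numerator $1$ if the denominator is $0$) such that $ry-xs=1$, $p=x+y$, $q=r+s$. Put $i(\alpha)=\frac{q-p}{q}$, $r(\alpha)=\frac rq$, $(ir)(\alpha)=\frac sq$. For a rational $\beta\in(0,1)$ write $\beta=[0,b_1,\dots,b_n]=\cfrac{1}{b_1+\cfrac{1}{\ddots+\cfrac1{b_n}}}$ with integers $b_j\ge 1$, and set $$\mathrm{wt}(\beta)=\sum_{j=1}^n(-1)^jb_j\ \text{ if } n \text{ is even},\qquad \mathrm{wt}(\beta)=2+\sum_{j=1}^n(-1)^jb_j\ \text{ if } n\text{ is odd}.$$ Let $T(\beta)$ be the rational $(2,2)$-tangle diagram of $\beta$: start from two horizontal arcs if $n$ is even and from two vertical arcs if $n$ is odd, and, for $j=n,n-1,\dots,1$, add $b_j$ crossings one after another, on the right if $j$ is even and below if $j$ is odd; at each crossing the strand from upper left to lower right is the over strand. Let $D(T(\beta))$ be the link diagram obtained by joining the two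 left end points of $T(\beta)$ by an arc and the two right end points by an arc. If $\beta$ has odd denominator, $D(T(\beta))$ is a knot diagram, and $\mathrm{wr}(\beta)$ denotes its writhe. If $\beta$ has even denominator, $D(T(\beta))$ has two components, one through each closing arc; then $\mathrm{wr}(\beta)$ denotes the writhe of $D(T(\beta))$ oriented so that the left closing arc runs upwards and the right one downwards, and $\mathrm{wr}_{+-}(\beta)$ the writhe after the orientation of one of the two components is reversed. These integers depend only on $\beta$. Put $$\widetilde{\mathrm{wt}}(\beta)=-\mathrm{wr}(\beta)-\mathrm{wt}(\beta),\qquad \widetilde{\mathrm{wt}}_{+-}(\beta)=-\mathrm{wr}_{+-}(\beta)-\mathrm{wt}(\beta),$$ the latter for $\beta$ with even denominator. Then: 1. If $q$ is odd, then $\widetilde{\mathrm{wt}}(i(\alpha))=\widetilde{\mathrm{wt}}((ir)(\alpha))=-\widetilde{\mathrm{wt}}(\alpha)$ and $\widetilde{\mathrm{wt}}(r(\alpha))=\widetilde{\mathrm{wt}}(\alpha)$. 2. If $q$ and $x$ are even, then $\widetilde{\mathrm{wt}}(i(\alpha))=\widetilde{\mathrm{wt}}((ir)(\alpha))=-\widetilde{\mathrm{wt}}_{+-}(\alpha)$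 and $\widetilde{\mathrm{wt}}(r(\alpha))=\widetilde{\mathrm{wt}}(\alpha)$. 3. If $q$ and $y$ are even, then $\widetilde{\mathrm{wt}}(i(\alpha))=-\widetilde{\mathrm{wt}}_{+-}(\alpha)$, $\widetilde{\mathrm{wt}}((ir)(\alpha))=-\widetilde{\mathrm{wt}}(\alpha)$ and $\widetilde{\mathrm{wt}}(r(\alpha))=\widetilde{\mathrm{wt}}_{+-}(\alpha)$. -/

import Mathlib

namespace RationalLink

/-! ### Continued fractions -/

/-- Euclid's algorithm: for `0 < q` this is the list `[a₀, a₁, …, aₙ]` with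
`p / q = a₀ + 1 / (a₁ + 1 / (⋯ + 1 / aₙ))`, where `a₁, …, aₙ ≥ 1` (and `aₙ ≥ 2` if `1 ≤ n`). -/
def euclid (p : ℕ) : ℕ → List ℕ
  | 0 => []
  | q + 1 => p / (q + 1) :: euclid (q + 1) (p % (q + 1))
termination_by q => q
decreasing_by exact Nat.mod_lt _ (Nat.succ_pos _)

/-- The continued fraction expansion `[a₀, a₁, …, aₙ]` of a rational number `α ≥ 0`. -/
def expansion (α : ℚ) : List ℕ := euclid α.num.toNat α.den

/-- `a₀ - a₁ + a₂ - ⋯ ± aₙ`. -/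
def altSum : List ℕ → ℤ
  | [] => 0
  | a :: l => (a : ℤ) - altSum l

/-- The weight of `[a₀, a₁, …, aₙ]`: the alternating sum if `n` is even (the list has odd length),
the alternating sum plus `2` if `n` is odd (the list has even length). -/
def weightOf (l : List ℕ) : ℤ := if Odd l.length then altSum l else altSum l + 2

/-- The weight `wt(α)`. -/
def wt (α : ℚ) : ℤ := weightOf (expansion α)

/-! ### Rational tangle diagrams

A `(2,2)`-tangle diagram lies in a disk with the four boundary points NW, NE, SW, SE. The only
crossing used here is the one of the tangle `T(1)`: its two strands are the diagonals NW–SE and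
SW–NE, and the strand NW–SE passes over the strand SW–NE. -/

/-- Rational tangle diagrams, built from the two crossingless diagrams by adding crossings. -/
inductive Tangle
  /-- The arcs NW–NE and SW–SE. -/
  | zero : Tangle
  /-- The arcs NW–SW and NE–SE. -/
  | infty : Tangle
  /-- Glue a crossing to the right of `T`: the points NE, SE of `T` are joined to the points NW, SW
  of the crossing. -/
  | addRight (T : Tangle) : Tangle
  /-- Glue a crossing below `T`: the points SW, SE of `T` are joined to the points NW, NE of the
  crossing. -/
  | addBelow (T : Tangle) : Tangle

/-- `ofList true [b₀, b₁, …]` is the rational tangle diagram with fraction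
`b₀ + 1 / (b₁ + 1 / (b₂ + ⋯))`, and `ofList false [b₀, b₁, …]` the one with fraction
`1 / (b₀ + 1 / (b₁ + ⋯))`. Horizontal twists (crossings added on the right) and vertical twists
(crossings added below) alternate, the first entry being the outermost block. -/
def Tangle.ofList : Bool → List ℕ → Tangle
  | true, [] => .infty
  | false, [] => .zero
  | true, b :: l => Tangle.addRight^[b] (Tangle.ofList false l)
  | false, b :: l => Tangle.addBelow^[b] (Tangle.ofList true l)

/-- The tangle diagram `T(α)`: with `α = [a₀, a₁, …, aₙ]`, the even-indexed entries are blocks of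
horizontal twists and the odd-indexed entries are blocks of vertical twists. -/
def tangle (α : ℚ) : Tangle := Tangle.ofList true (expansion α)

/-! ### Orientations and writhe -/

/-- Directions of the strands of a tangle diagram at its four boundary points:
`true` if the strand runs into the disk there, `false` if it runs out of the disk. -/
structure Ends where
  nw : Bool
  ne : Bool
  sw : Bool
  se : Bool

/-- Directions at the boundary of `T` when those at the boundary of `T.addRight` are `e`. The
crossing has the strands NW–SE and SW–NE, so what runs into it at SE runs out of it at NW and hence
into `T` at NE; likewise what runs into it at NE runs into `T` at SE. -/
def Ends.innerRight (e : Ends) : Ends := ⟨e.nw, e.se, e.sw, e.ne⟩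

/-- Directions at the boundary of `T` when those at the boundary of `T.addBelow` are `e`. -/
def Ends.innerBelow (e : Ends) : Ends := ⟨e.nw, e.ne, e.se, e.sw⟩

/-- The boundary directions `e` extend to an orientation of all strands of the tangle diagram. (The
orientation is then unique, since every strand of a rational tangle diagram ends at the
boundary.) -/
def Tangle.Oriented : Tangle → Ends → Prop
  | .zero, e => e.nw ≠ e.ne ∧ e.sw ≠ e.se
  | .infty, e => e.nw ≠ e.sw ∧ e.ne ≠ e.se
  | .addRight T, e => T.Oriented e.innerRight
  | .addBelow T, e => T.Oriented e.innerBelow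

instance Tangle.decidableOriented : (T : Tangle) → (e : Ends) → Decidable (T.Oriented e)
  | .zero, e => inferInstanceAs (Decidable (e.nw ≠ e.ne ∧ e.sw ≠ e.se))
  | .infty, e => inferInstanceAs (Decidable (e.nw ≠ e.sw ∧ e.ne ≠ e.se))
  | .addRight T, e => Tangle.decidableOriented T e.innerRight
  | .addBelow T, e => Tangle.decidableOriented T e.innerBelow

/-- The sign of an oriented crossing, from the directions at its points NW and SW (`true` means
into the crossing). The over strand has direction `(1,-1)` if it enters at NW and `(-1,1)` if it
enters at SE; the under strand has direction `(1,1)` if it enters at SW and `(-1,-1)` if it enters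
at NE. The sign is that of the determinant of the pair (over, under), as for any oriented
crossing. -/
def crossingSign (nw sw : Bool) : ℤ :=
  let o : ℤ × ℤ := if nw then (1, -1) else (-1, 1)
  let u : ℤ × ℤ := if sw then (1, 1) else (-1, -1)
  (o.1 * u.2 - o.2 * u.1).sign

/-- The sum of the signs of all crossings of a tangle diagram, oriented with boundary directions
`e`. At the outermost crossing the directions at NW and SW are found from those at the opposite ends
of its two strands: on the right, NW is opposite to the boundary point SE and SW to NE; below, NW is
opposite to the boundary point SE and SW is itself a boundary point. -/
def Tangle.writhe : Tangle → Ends → ℤ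
  | .zero, _ => 0
  | .infty, _ => 0
  | .addRight T, e => crossingSign (!e.se) (!e.ne) + T.writhe e.innerRight
  | .addBelow T, e => crossingSign (!e.se) e.sw + T.writhe e.innerBelow

/-! The denominator `D(T)` is obtained from `T` by joining NW to SW by an arc on the left and NE to
SE by an arc on the right. An orientation of `D(T)` is an orientation of `T` with opposite
directions at NW and SW and opposite directions at NE and SE. -/

/-- The left closing arc of the denominator runs upwards and the right one downwards. -/
def upDown : Ends := ⟨true, false, false, true⟩

/-- Both closing arcs of the denominator run upwards. -/
def upUp : Ends := ⟨true, true, false, false⟩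

/-- Up to reversing everything, one of the two choices always orients the denominator. -/
theorem Tangle.oriented_upDown_or_upUp (T : Tangle) :
    T.Oriented upDown ∨ T.Oriented upUp := by
  suffices h : ∀ T : Tangle,
      (∀ e : Ends, T.Oriented e ↔ e.nw ≠ e.ne ∧ e.sw ≠ e.se) ∨
      (∀ e : Ends, T.Oriented e ↔ e.nw ≠ e.sw ∧ e.ne ≠ e.se) ∨
      (∀ e : Ends, T.Oriented e ↔ e.nw ≠ e.se ∧ e.ne ≠ e.sw) by
    rcases h T with h | h | h <;> simp [h, upDown, upUp]
  intro T
  induction T with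
  | zero => exact Or.inl fun e => Iff.rfl
  | infty => exact Or.inr (Or.inl fun e => Iff.rfl)
  | addRight T ih =>
    rcases ih with h | h | h
    · refine Or.inr (Or.inr fun e => ?_)
      simp only [Tangle.Oriented, h, Ends.innerRight]
      exact and_congr_right fun _ => ne_comm
    · refine Or.inr (Or.inl fun e => ?_)
      simp only [Tangle.Oriented, h, Ends.innerRight]
      exact and_congr_right fun _ => ne_comm
    · refine Or.inl fun e => ?_
      simp only [Tangle.Oriented, h, Ends.innerRight]
      exact and_congr_right fun _ => ne_comm
  | addBelow T ih =>
    rcases ih with h | h | h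
    · refine Or.inl fun e => ?_
      simp only [Tangle.Oriented, h, Ends.innerBelow]
      exact and_congr_right fun _ => ne_comm
    · refine Or.inr (Or.inr fun e => ?_)
      simp only [Tangle.Oriented, h, Ends.innerBelow]
    · refine Or.inr (Or.inl fun e => ?_)
      simp only [Tangle.Oriented, h, Ends.innerBelow]

/-- The writhe `wr(α)` of the diagram `D(T(α))`. If the denominator of `α` is even, `D(T(α))` has
two components, one through each closing arc, and it is oriented so that the left closing arc runs
upwards and the right one downwards. If the denominator is odd, `D(T(α))` is a knot diagram, and it
has only one orientation for which the left closing arc runs upwards. -/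
def wr (α : ℚ) : ℤ :=
  if (tangle α).Oriented upDown then (tangle α).writhe upDown else (tangle α).writhe upUp

/-- For `α` with even denominator, the writhe `wr₊₋(α)` of `D(T(α))` with the orientation of the
component through the right closing arc reversed. -/
def wrPM (α : ℚ) : ℤ := (tangle α).writhe upUp

/-- The extended weight `-wr(α) - wt(α)`. -/
def extWt (α : ℚ) : ℤ := -wr α - wt α

/-- The extended weight for the other orientation, `-wr₊₋(α) - wt(α)`, for `α` with even
denominator. -/
def extWtPM (α : ℚ) : ℤ := -wrPM α - wt α

/-! ### Farey parents and the operations `i`, `r`, `ir` -/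

/-- `(x/r, y/s)` is the pair of parents of the irreducible fraction `p/q`: the fractions `x/r` and
`y/s` (with denominators `≥ 0`, and numerator `1` if the denominator is `0`) are Farey neighbors,
`r y - x s = 1`, and `p/q` is their mediant. -/
structure IsParents (x r y s p q : ℤ) : Prop where
  left_nonneg : 0 ≤ r
  left_infty : r = 0 → x = 1
  right_nonneg : 0 ≤ s
  right_infty : s = 0 → y = 1
  neighbors : r * y - x * s = 1
  num_eq : p = x + y
  den_eq : q = r + s

end RationalLink

namespace RationalLink

/-! ### Boundary orientations and words of crossings -/

/-! A fraction p/q in (0,1) is encoded by a word `w` of crossings (on the right or below) with `num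
w / den w` equal to p/(q-p). By `encodes_frac` its diagram behaves like one crossing surrounded by
`false :: w`. Exchanging the two letters of `w` realises i, reversing `w` realises r
(`frac_map_not`, `frac_reverse`), and the parents can be read off `mat w`
(`exists_word_of_isParents`).

Up to total reversal, the relevant boundary orientations are three pairings. Each crossing acts on
them by an involution and adds a local cost to the extended weight. This cost is the same seen from
outside or inside, and the reflection `swap` negates it. Once the contributions of the two ends are
split symmetrically by `height`, the extended weight is `defect w S`, which is invariant under
reversal (`defect_reverse`) and negated by exchanging letters (`defect_map_not`).

It remains to match orientations. The pairings are the nonzero vectors modulo 2, permuted by the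
inverse of `mat w` (`mat_mul_vec_run`), so the parities of q, x and y decide which orientation goes
to which. -/

/-- The boundary directions with two strands running in and two running out, up to total reversal:
the boundary point whose direction agrees with the one at NW. -/
inductive Pairing
  | se
  | ne
  | sw
  deriving DecidableEq

namespace Pairing

/-- The boundary directions of a pairing that run into the disk at NW. -/
def ends : Pairing → Ends
  | se => upDown
  | ne => upUp
  | sw => ⟨true, false, true, false⟩

/-- The pairing inside of an outermost crossing, which is on the right for `true` and below for
`false`. -/
def step : Bool → Pairing → Pairing
  | true, se => ne
  | true, ne => se
  | true, sw => sw
  | false, se => sw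
  | false, sw => se
  | false, ne => ne

/-- The contribution of an outermost crossing to the extended weight. -/
def cost : Bool → Pairing → ℤ
  | true, sw => -2
  | false, ne => 2
  | _, _ => 0

/-- The reflection exchanging crossings on the right and crossings below. -/
def swap : Pairing → Pairing
  | se => se
  | ne => sw
  | sw => ne

/-- The pairing inside of a sequence of crossings, listed from the outermost one. -/
def run : List Bool → Pairing → Pairing
  | [], S => S
  | g :: w, S => run w (step g S)

/-- The contribution of a sequence of crossings to the extended weight. -/
def total : List Bool → Pairing → ℤ
  | [], _ => 0
  | g :: w, S => cost g S + total w (step g S)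

theorem step_step (g : Bool) (S : Pairing) : step g (step g S) = S := by
  cases g <;> cases S <;> rfl

theorem cost_step (g : Bool) (S : Pairing) : cost g (step g S) = cost g S := by
  cases g <;> cases S <;> rfl

theorem step_not_swap (g : Bool) (S : Pairing) : step (!g) (swap S) = swap (step g S) := by
  cases g <;> cases S <;> rfl

theorem cost_not_swap (g : Bool) (S : Pairing) : cost (!g) (swap S) = -cost g S := by
  cases g <;> cases S <;> rfl

theorem run_append (v w : List Bool) (S : Pairing) : run (v ++ w) S = run w (run v S) := by
  induction v generalizing S with
  | nil => rfl
  | cons g v ih => exact ih _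

theorem total_append (v w : List Bool) (S : Pairing) :
    total (v ++ w) S = total v S + total w (run v S) := by
  induction v generalizing S with
  | nil => simp [total, run]
  | cons g v ih => simp [total, run, ih, add_assoc]

theorem run_reverse (w : List Bool) (S : Pairing) : run w.reverse (run w S) = S := by
  induction w generalizing S with
  | nil => rfl
  | cons g w ih => simp [run, run_append, ih, step_step]

/-- Each step is an involution with the same cost at both ends, so the reversed word retraces the
same pairings at the same costs. -/
theorem total_reverse (w : List Bool) (S : Pairing) : total w.reverse (run w S) = total w S := by
  induction w generalizing S with
  | nil => rfl
  | cons g w ih => simp [run, total, total_append, ih, run_reverse, cost_step, add_comm]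

theorem run_map_not (w : List Bool) (S : Pairing) :
    run (w.map not) (swap S) = swap (run w S) := by
  induction w generalizing S with
  | nil => rfl
  | cons g w ih => simp [run, step_not_swap, ih]

theorem total_map_not (w : List Bool) (S : Pairing) :
    total (w.map not) (swap S) = -total w S := by
  induction w generalizing S with
  | nil => rfl
  | cons g w ih => simp [total, step_not_swap, cost_not_swap, ih, add_comm]

/-- The contribution of the two extremal pairings to the extended weight. -/
def height : Pairing → ℤ
  | se => 0
  | ne => 1
  | sw => -1

/-- The extended weight of the tangle diagram with the crossings `false :: w` around a crossing,
when the pairing inside of the outermost crossing is `S`. -/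
def defect (w : List Bool) (S : Pairing) : ℤ := total w S + height S + height (run w S)

theorem defect_reverse (w : List Bool) (S : Pairing) :
    defect w.reverse (run w S) = defect w S := by
  simp only [defect, total_reverse, run_reverse]
  ring

theorem height_swap (S : Pairing) : height (swap S) = -height S := by
  cases S <;> rfl

theorem defect_map_not (w : List Bool) (S : Pairing) :
    defect (w.map not) (swap S) = -defect w S := by
  simp only [defect, total_map_not, run_map_not, height_swap]
  ring

end Pairing

/-! ### Words and fractions -/

/-- The matrix of a crossing. -/
def gen : Bool → Matrix (Fin 2) (Fin 2) ℕ
  | true => !![1, 1; 0, 1]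
  | false => !![1, 0; 1, 1]

/-- The matrix of a sequence of crossings. -/
def mat (w : List Bool) : Matrix (Fin 2) (Fin 2) ℕ := (w.map gen).prod

theorem mat_cons (g : Bool) (w : List Bool) : mat (g :: w) = gen g * mat w := by
  simp [mat]

theorem mat_det (w : List Bool) : mat w 0 0 * mat w 1 1 = mat w 0 1 * mat w 1 0 + 1 := by
  induction w with
  | nil => simp [mat]
  | cons g w ih =>
    cases g <;> simp [mat_cons, gen, Matrix.mul_apply, Fin.sum_univ_two] <;> linarith

/-- Conjugation by the permutation matrix exchanges the two generators. -/
theorem mat_map_not (w : List Bool) :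
    mat (w.map not) = !![mat w 1 1, mat w 1 0; mat w 0 1, mat w 0 0] := by
  induction w with
  | nil => ext i j; fin_cases i <;> fin_cases j <;> simp [mat]
  | cons g w ih =>
    rw [List.map_cons, mat_cons, ih]
    cases g <;> ext i j <;> fin_cases i <;> fin_cases j <;>
      simp [mat_cons, gen, Matrix.mul_apply, Fin.sum_univ_two, add_comm]

/-- Transposition followed by conjugation with the permutation matrix is an antiautomorphism fixing
both generators. -/
theorem mat_reverse (w : List Bool) :
    mat w.reverse = !![mat w 1 1, mat w 0 1; mat w 1 0, mat w 0 0] := by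
  induction w with
  | nil => ext i j; fin_cases i <;> fin_cases j <;> simp [mat]
  | cons g w ih =>
    have h : mat (g :: w).reverse = mat w.reverse * gen g := by simp [mat]
    rw [h, ih]
    cases g <;> ext i j <;> fin_cases i <;> fin_cases j <;>
      simp [mat_cons, gen, Matrix.mul_apply, Fin.sum_univ_two, add_comm]

/-- The numerator of the fraction of a sequence of crossings around a crossing. -/
def num (w : List Bool) : ℕ := mat w 0 0 + mat w 0 1

/-- The denominator of the fraction of a sequence of crossings around a crossing. -/
def den (w : List Bool) : ℕ := mat w 1 0 + mat w 1 1

theorem num_nil : num [] = 1 := by simp [num, mat]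

theorem den_nil : den [] = 1 := by simp [den, mat]

theorem num_cons_true (w : List Bool) : num (true :: w) = num w + den w := by
  simp [num, den, mat_cons, gen, Matrix.mul_apply, Fin.sum_univ_two]; ring

theorem den_cons_true (w : List Bool) : den (true :: w) = den w := by
  simp [den, mat_cons, gen, Matrix.mul_apply, Fin.sum_univ_two]

theorem num_cons_false (w : List Bool) : num (false :: w) = num w := by
  simp [num, mat_cons, gen, Matrix.mul_apply, Fin.sum_univ_two]

theorem den_cons_false (w : List Bool) : den (false :: w) = num w + den w := by
  simp [num, den, mat_cons, gen, Matrix.mul_apply, Fin.sum_univ_two]; ring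

theorem num_pos (w : List Bool) : 0 < num w := by
  have := mat_det w
  by_contra h
  obtain ⟨h1, h2⟩ : mat w 0 0 = 0 ∧ mat w 0 1 = 0 := by simp only [num] at h; omega
  simp [h1, h2] at this

theorem den_pos (w : List Bool) : 0 < den w := by
  have := mat_det w
  by_contra h
  obtain ⟨h1, h2⟩ : mat w 1 0 = 0 ∧ mat w 1 1 = 0 := by simp only [den] at h; omega
  simp [h1, h2] at this

theorem coprime_num_den (w : List Bool) : (num w).Coprime (den w) := by
  induction w with
  | nil => simp [num_nil]
  | cons g w ih =>
    cases g
    · simpa [num_cons_false, den_cons_false] using ih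
    · simpa [num_cons_true, den_cons_true] using ih

theorem num_eq_den_iff (w : List Bool) : num w = den w ↔ w = [] := by
  have h := num_pos
  have h' := den_pos
  cases w with
  | nil => simp [num_nil, den_nil]
  | cons g w =>
    cases g
    · simpa [num_cons_false, den_cons_false] using (h' w).ne'
    · simpa [num_cons_true, den_cons_true] using (h w).ne'

/-- Subtractive Euclidean algorithm: each subtraction contributes one letter. -/
theorem exists_word (a b : ℕ) (ha : 0 < a) (hb : 0 < b) (hab : a.Coprime b) :
    ∃ w, num w = a ∧ den w = b := by
  induction hn : a + b using Nat.strong_induction_on generalizing a b with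
  | _ n ih =>
    rcases lt_trichotomy a b with h | rfl | h
    · obtain ⟨c, rfl⟩ := Nat.exists_eq_add_of_lt h
      obtain ⟨w, h1, h2⟩ := ih (a + (c + 1)) (by omega) a (c + 1) ha (by omega)
        (by simpa [add_assoc] using hab) rfl
      exact ⟨false :: w, by rw [num_cons_false, h1], by rw [den_cons_false, h1, h2]; ring⟩
    · have : a = 1 := by simpa using hab
      exact ⟨[], by rw [num_nil, this], by rw [den_nil, this]⟩
    · obtain ⟨c, rfl⟩ := Nat.exists_eq_add_of_lt h
      obtain ⟨w, h1, h2⟩ := ih (c + 1 + b) (by omega) (c + 1) b (by omega) hb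
        (by simpa [add_assoc] using hab) rfl
      exact ⟨true :: w, by rw [num_cons_true, h1, h2]; ring, by rw [den_cons_true, h2]⟩

/-! ### Extended weights from words -/

/-- The extended weight of the tangle diagram of a continued fraction, for the boundary directions
`e`. -/
def listDefect (l : List ℕ) (e : Ends) : ℤ := -(Tangle.ofList true l).writhe e - weightOf l

theorem ofList_zero_zero (l : List ℕ) :
    Tangle.ofList true (0 :: 0 :: l) = Tangle.ofList true l := rfl

theorem ofList_succ (k : ℕ) (l : List ℕ) :
    Tangle.ofList true ((k + 1) :: l) = .addRight (Tangle.ofList true (k :: l)) :=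
  Function.iterate_succ_apply' _ _ _

theorem ofList_zero_succ (k : ℕ) (l : List ℕ) :
    Tangle.ofList true (0 :: (k + 1) :: l) = .addBelow (Tangle.ofList true (0 :: k :: l)) :=
  Function.iterate_succ_apply' _ _ _

theorem weightOf_zero_zero (l : List ℕ) : weightOf (0 :: 0 :: l) = weightOf l := by
  simp [weightOf, altSum, Nat.odd_add_one]

theorem weightOf_succ (k : ℕ) (l : List ℕ) :
    weightOf ((k + 1) :: l) = weightOf (k :: l) + 1 := by
  simp only [weightOf, altSum, List.length_cons]
  split_ifs <;> push_cast <;> ring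

theorem weightOf_zero_succ (k : ℕ) (l : List ℕ) :
    weightOf (0 :: (k + 1) :: l) = weightOf (0 :: k :: l) - 1 := by
  simp only [weightOf, altSum, List.length_cons]
  split_ifs <;> push_cast <;> ring

/-- The contribution of the innermost crossing to the extended weight. -/
def Pairing.core : Pairing → ℤ
  | sw => -2
  | _ => 0

open Pairing

/-- The tangle diagram of the continued fraction `l` behaves like a crossing surrounded by the
crossings `w`. -/
def Encodes (l : List ℕ) (w : List Bool) : Prop := ∀ S : Pairing,
  ((Tangle.ofList true l).Oriented S.ends ↔ run w S ≠ se) ∧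
  (run w S ≠ se → listDefect l S.ends = total w S + core (run w S))

theorem Encodes.zero_zero {l : List ℕ} {w : List Bool} (h : Encodes l w) :
    Encodes (0 :: 0 :: l) w := by
  simpa only [Encodes, listDefect, ofList_zero_zero, weightOf_zero_zero] using h

theorem ends_step_true (S : Pairing) : S.ends.innerRight = (step true S).ends := by
  cases S <;> rfl

theorem ends_step_false (S : Pairing) : S.ends.innerBelow = (step false S).ends := by
  cases S <;> rfl

theorem cost_true (S : Pairing) :
    cost true S = -crossingSign (!S.ends.se) (!S.ends.ne) - 1 := by
  cases S <;> decide

theorem cost_false (S : Pairing) :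
    cost false S = -crossingSign (!S.ends.se) S.ends.sw + 1 := by
  cases S <;> decide

theorem Encodes.succ {k : ℕ} {l : List ℕ} {w : List Bool} (h : Encodes (k :: l) w) :
    Encodes ((k + 1) :: l) (true :: w) := by
  intro S
  obtain ⟨h1, h2⟩ := h (step true S)
  simp only [listDefect, ofList_succ, weightOf_succ, Tangle.Oriented, Tangle.writhe, run, total,
    ends_step_true, cost_true] at h2 ⊢
  exact ⟨h1, fun hS => by linarith [h2 hS]⟩

theorem Encodes.zero_succ {k : ℕ} {l : List ℕ} {w : List Bool} (h : Encodes (0 :: k :: l) w) :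
    Encodes (0 :: (k + 1) :: l) (false :: w) := by
  intro S
  obtain ⟨h1, h2⟩ := h (step false S)
  simp only [listDefect, ofList_zero_succ, weightOf_zero_succ, Tangle.Oriented, Tangle.writhe, run,
    total, ends_step_false, cost_false] at h2 ⊢
  exact ⟨h1, fun hS => by linarith [h2 hS]⟩

theorem encodes_one : Encodes [1] [] := by
  intro S
  cases S <;> decide

/-- The summand 2 in `weightOf` for lists of even length gives `[0, 1]` the same weight as `[1]`. -/
theorem encodes_zero_one : Encodes [0, 1] [] := by
  intro S
  cases S <;> decide

/-! ### Euclid's algorithm read as a word of crossings -/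

theorem euclid_of_pos (a : ℕ) {b : ℕ} (hb : 0 < b) : euclid a b = a / b :: euclid b (a % b) := by
  obtain ⟨c, rfl⟩ := Nat.exists_eq_add_of_lt hb
  simp [euclid]

theorem euclid_of_lt {a b : ℕ} (h : a < b) : euclid a b = 0 :: euclid b a := by
  rw [euclid_of_pos a (by omega), Nat.div_eq_of_lt h, Nat.mod_eq_of_lt h]

theorem euclid_add_self (a : ℕ) {b : ℕ} (hb : 0 < b) :
    euclid (a + b) b = (a / b + 1) :: euclid b (a % b) := by
  rw [euclid_of_pos _ hb, Nat.add_div_right _ hb, Nat.add_mod_right]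

theorem euclid_one_one : euclid 1 1 = [1] := by simp [euclid]

/-- `Encodes.zero_succ` needs a list with leading 0. The form here starts with 0 whichever of `num
w` and `den w` is larger, at the price of a possible harmless `0 :: 0`. -/
theorem Encodes.zero_cons {w : List Bool} (h : Encodes (euclid (num w) (den w)) w) :
    Encodes (0 :: euclid (den w) (num w)) w := by
  rcases lt_trichotomy (num w) (den w) with hlt | heq | hlt
  · rwa [euclid_of_lt hlt] at h
  · obtain rfl := (num_eq_den_iff w).1 heq
    rw [num_nil, den_nil, euclid_one_one]
    exact encodes_zero_one
  · rw [euclid_of_lt hlt]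
    exact h.zero_zero

theorem encodes_euclid (w : List Bool) : Encodes (euclid (num w) (den w)) w := by
  induction w with
  | nil => rw [num_nil, den_nil, euclid_one_one]; exact encodes_one
  | cons g w ih =>
    cases g
    · have h := ih.zero_cons
      have hn := num_pos w
      have hd := den_pos w
      rw [num_cons_false, den_cons_false, euclid_of_lt (by omega), add_comm (num w),
        euclid_add_self _ hn]
      rw [euclid_of_pos _ hn] at h
      exact h.zero_succ
    · rw [num_cons_true, den_cons_true, euclid_add_self _ (den_pos w)]
      rw [euclid_of_pos _ (den_pos w)] at ih
      exact ih.succ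

theorem expansion_div {a b : ℕ} (hb : 0 < b) (hab : a.Coprime b) :
    expansion ((a : ℚ) / b) = euclid a b := by
  have h1 : ((a : ℤ) / (b : ℤ) : ℚ).num = a := Rat.num_div_eq_of_coprime (by omega) (by simpa)
  have h2 : (((a : ℤ) / (b : ℤ) : ℚ).den : ℤ) = b :=
    Rat.den_div_eq_of_coprime (by omega) (by simpa)
  push_cast at h1 h2
  simp only [expansion, h1]
  norm_cast at h2 ⊢
  simp [h2]

/-- The fraction with the crossings `false :: w` around a crossing. -/
def frac (w : List Bool) : ℚ := (num w : ℚ) / ((num w + den w : ℕ) : ℚ)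

theorem encodes_frac (w : List Bool) : Encodes (expansion (frac w)) (false :: w) := by
  have h := encodes_euclid (false :: w)
  rwa [← expansion_div (den_pos _) (coprime_num_den _), num_cons_false, den_cons_false] at h

/-- The outermost crossing fixes `ne` at cost 2, and 2 plus the innermost contribution is the sum of
the two heights. -/
theorem extWtPM_frac {w : List Bool} (h : run w ne ≠ se) : extWtPM (frac w) = defect w ne := by
  have h1 := (encodes_frac w ne).2 h
  rw [extWtPM, wrPM, wt]
  refine h1.trans ?_
  simp only [total, run, step, cost, defect, height] at h ⊢
  cases hS : run w ne <;> simp_all [core]; ring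

/-- The outermost crossing turns `se` into `sw` at no cost, so the two heights must add up to the
innermost contribution alone. -/
theorem extWt_frac {w : List Bool} (h : run w sw ≠ se) : extWt (frac w) = defect w sw := by
  obtain ⟨h0, h1⟩ := encodes_frac w se
  have hO : (tangle (frac w)).Oriented upDown := h0.2 h
  rw [extWt, wr, wt, if_pos hO]
  refine (h1 h).trans ?_
  simp only [total, run, step, cost, defect, height] at h ⊢
  cases hS : run w sw <;> simp_all [core]; ring

theorem extWt_frac' {w : List Bool} (h : run w sw = se) (h' : run w ne ≠ se) :
    extWt (frac w) = defect w ne := by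
  rw [← extWtPM_frac h', extWt, extWtPM, wr, wrPM, if_neg]
  exact fun hO => (encodes_frac w se).1.1 hO h

/-! ### Parity -/

/-- The vector modulo two of a pairing. -/
def Pairing.vec : Pairing → Fin 2 → ℕ
  | se => ![1, 1]
  | ne => ![0, 1]
  | sw => ![1, 0]

theorem mat_mul_vec_run (w : List Bool) (S : Pairing) (i : Fin 2) :
    (mat w i 0 * vec (run w S) 0 + mat w i 1 * vec (run w S) 1) % 2 = vec S i % 2 := by
  induction w generalizing S i with
  | nil => fin_cases i <;> simp [mat, run]
  | cons g w ih =>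
    have h0 := ih (step g S) 0
    have h1 := ih (step g S) 1
    simp only [run]
    generalize run w (step g S) = E at *
    cases g <;> cases S <;> fin_cases i <;> cases E <;>
      simp [mat_cons, gen, Matrix.mul_apply, Fin.sum_univ_two, vec, step] at h0 h1 ⊢ <;> omega


theorem run_injective (w : List Bool) : Function.Injective (run w) :=
  Function.LeftInverse.injective (g := run w.reverse) (run_reverse w)

theorem run_reverse' (w : List Bool) (S : Pairing) : run w (run w.reverse S) = S := by
  simpa using run_reverse w.reverse S

theorem run_sw_of_run_ne {w : List Bool} (h : run w se ≠ se) (h' : run w ne ≠ se) :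
    run w sw = se := by
  have := run_reverse' w se
  cases hS : run w.reverse se <;> simp_all

/-- Ending at `se`, the vector (1,1), forces `S` to be (`num w`, `den w`) modulo 2; an even sum
leaves only (1,1). -/
theorem run_se_of_even {w : List Bool} (hw : Even (num w + den w)) (S : Pairing)
    (hS : run w S = se) : S = se := by
  have h0 := mat_mul_vec_run w S 0
  have h1 := mat_mul_vec_run w S 1
  rw [hS] at h0 h1
  rw [Nat.even_iff] at hw
  simp only [num, den] at hw
  cases S <;> simp [vec] at h0 h1 ⊢ <;> omega

theorem run_se_ne_of_odd {w : List Bool} (hw : Odd (num w + den w)) : run w se ≠ se := by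
  intro hS
  have h0 := mat_mul_vec_run w se 0
  have h1 := mat_mul_vec_run w se 1
  rw [hS] at h0 h1
  rw [Nat.odd_iff] at hw
  simp only [num, den] at hw
  simp [vec] at h0 h1
  omega

theorem run_sw_of_even_right {w : List Bool} (hw : Even (num w + den w)) (hx : Even (mat w 0 1)) :
    run w sw = sw := by
  have h0 := mat_mul_vec_run w sw 0
  cases hS : run w sw with
  | se => exact (run_se_of_even hw _ hS).symm
  | sw => rfl
  | ne =>
    rw [hS] at h0
    rw [Nat.even_iff] at hx
    simp [vec] at h0
    omega

theorem run_sw_of_even_left {w : List Bool} (hw : Even (num w + den w)) (hy : Even (mat w 0 0)) :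
    run w sw = ne := by
  have h0 := mat_mul_vec_run w sw 0
  cases hS : run w sw with
  | se => cases run_se_of_even hw _ hS
  | ne => rfl
  | sw =>
    rw [hS] at h0
    rw [Nat.even_iff] at hy
    simp [vec] at h0
    omega

/-! ### Symmetries of the extended weight -/

/-- The case of odd denominator: the preimage of `se` under the permutation `run w` is `ne` or `sw`,
and the other of these two gives the orientation that defines the writhe. -/
theorem extWt_frac_of_run_se {w : List Bool} (hw : run w se ≠ se) {S : Pairing} (hS : S ≠ se)
    (hr : run w S ≠ se) : extWt (frac w) = defect w S := by
  cases S with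
  | se => exact absurd rfl hS
  | sw => exact extWt_frac hr
  | ne => exact extWt_frac' (run_sw_of_run_ne hw hr) hr

theorem exists_run_ne_se (w : List Bool) : ∃ S, S ≠ se ∧ run w S ≠ se := by
  by_cases h : run w ne = se
  · exact ⟨sw, by decide, fun h' => by cases run_injective w (h.trans h'.symm)⟩
  · exact ⟨ne, by decide, h⟩

theorem swap_ne_se {S : Pairing} (h : S ≠ se) : swap S ≠ se := by
  cases S <;> simp_all [swap]

theorem extWt_map_not_of_run_se {w : List Bool} (hw : run w se ≠ se) :
    extWt (frac (w.map not)) = -extWt (frac w) := by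
  obtain ⟨S, hS, hr⟩ := exists_run_ne_se w
  rw [extWt_frac_of_run_se hw hS hr, ← defect_map_not]
  refine extWt_frac_of_run_se ?_ (swap_ne_se hS) (by rw [run_map_not]; exact swap_ne_se hr)
  have := run_map_not w se
  rw [swap] at this
  rw [this]
  exact swap_ne_se hw

theorem run_reverse_se_ne {w : List Bool} (hw : run w se ≠ se) : run w.reverse se ≠ se := by
  intro h
  have := run_reverse' w se
  rw [h] at this
  exact hw this

theorem extWt_reverse_of_run_se {w : List Bool} (hw : run w se ≠ se) :
    extWt (frac w.reverse) = extWt (frac w) := by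
  obtain ⟨S, hS, hr⟩ := exists_run_ne_se w
  rw [extWt_frac_of_run_se hw hS hr, ← defect_reverse]
  exact extWt_frac_of_run_se (run_reverse_se_ne hw) hr (by rwa [run_reverse])

theorem extWt_map_not_of_even {w : List Bool} (h : run w ne ≠ se) :
    extWt (frac (w.map not)) = -extWtPM (frac w) := by
  rw [extWtPM_frac h, ← defect_map_not]
  exact extWt_frac (w := w.map not) ((run_map_not w ne).trans_ne (swap_ne_se h))

/-! ### The symmetries on fractions, and the Farey parents -/

theorem frac_map_not (w : List Bool) :
    frac (w.map not) = (den w : ℚ) / ((num w + den w : ℕ) : ℚ) := by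
  simp only [frac, num, den, mat_map_not]
  simp
  ring

theorem frac_reverse (w : List Bool) :
    frac w.reverse = ((mat w 0 1 + mat w 1 1 : ℕ) : ℚ) / ((num w + den w : ℕ) : ℚ) := by
  simp only [frac, num, den, mat_reverse]
  simp
  ring

theorem frac_map_not_reverse (w : List Bool) :
    frac (w.reverse.map not) =
      ((mat w 0 0 + mat w 1 0 : ℕ) : ℚ) / ((num w + den w : ℕ) : ℚ) := by
  simp only [frac, num, den, mat_map_not, mat_reverse]
  simp
  ring

theorem exists_word_of_isParents {p q x r y s : ℤ} (hp : 0 < p) (hpq : p < q)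
    (hcop : IsCoprime p q) (hpar : IsParents x r y s p q) :
    ∃ w, p = num w ∧ q = (num w + den w : ℕ) ∧ x = mat w 0 1 ∧ y = mat w 0 0 ∧
      r = (mat w 0 1 + mat w 1 1 : ℕ) ∧ s = (mat w 0 0 + mat w 1 0 : ℕ) := by
  obtain ⟨hr, hr0, hs, hs0, hnb, hpx, hqr⟩ := hpar
  have hcop' : IsCoprime p (q - p) := by
    obtain ⟨u, v, h⟩ := hcop
    exact ⟨u + v, v, by linarith⟩
  lift p to ℕ using hp.le
  obtain ⟨d, hd⟩ := Int.eq_ofNat_of_zero_le (sub_nonneg.2 hpq.le)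
  rw [hd] at hcop'
  obtain ⟨w, h1, h2⟩ := exists_word p d (by omega) (by omega) (Nat.isCoprime_iff_coprime.1 hcop')
  have hdet := mat_det w
  have hq : q = (num w + den w : ℕ) := by rw [h1, h2]; push_cast; linarith
  have hpn : (p : ℤ) = mat w 0 0 + mat w 0 1 := by rw [← h1]; simp [num]
  have hqn : q = mat w 0 0 + mat w 0 1 + (mat w 1 0 + mat w 1 1) := by rw [hq]; simp [num, den]
  zify at hdet
  have hr1 : r * p - x * q = 1 := by rw [hpx, hqr]; linarith
  have hr2 : ((mat w 0 1 : ℤ) + mat w 1 1) * p - mat w 0 1 * q = 1 := by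
    rw [hpn, hqn]; linarith
  -- Both candidates for r are inverses of p modulo q; since both lie in [0, q), they agree.
  have hdvd : q ∣ r - (mat w 0 1 + mat w 1 1) := by
    refine hcop.symm.dvd_of_dvd_mul_right ⟨x - mat w 0 1, ?_⟩
    linarith
  -- If s = 0, then y = 1 and r = 1, so q = 1, which leaves no room for p.
  have hspos : 0 < s := by
    rcases hs.lt_or_eq with h | h
    · exact h
    · rw [hs0 h.symm, ← h] at hnb
      omega
  have hreq : r - (mat w 0 1 + mat w 1 1) = 0 := by
    refine Int.eq_zero_of_abs_lt_dvd hdvd (abs_lt.2 ?_)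
    have hpos : 0 < (mat w 0 0 : ℤ) + mat w 1 0 := by
      by_contra h
      have h00 : (mat w 0 0 : ℤ) = 0 := by omega
      have h10 : (mat w 1 0 : ℤ) = 0 := by omega
      rw [h00, h10] at hdet
      simp at hdet
    omega
  have hr3 : r = mat w 0 1 + mat w 1 1 := by linarith
  have hx : x = mat w 0 1 := by
    have : (x - mat w 0 1) * q = 0 := by rw [← hr3] at hr2; linarith
    rcases mul_eq_zero.1 this with h | h <;> omega
  refine ⟨w, by rw [h1], hq, hx, ?_, ?_, ?_⟩ <;> push_cast <;> linarith

end RationalLink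

/-- Here `α = p/q` has the parents `x/r < y/s`, so that `i(α) = (q - p)/q`, `r(α) = r/q` and
`(ir)(α) = s/q`. -/
theorem lemma4p5 (p q x r y s : ℤ) (hp : 0 < p) (hpq : p < q) (hcop : IsCoprime p q)
    (hpar : RationalLink.IsParents x r y s p q)
    (α iα rα irα : ℚ) (hα : α = (p : ℚ) / q) (hi : iα = ((q - p : ℤ) : ℚ) / q)
    (hr : rα = (r : ℚ) / q) (hir : irα = (s : ℚ) / q) :
    (Odd q →
      RationalLink.extWt iα = -RationalLink.extWt α ∧
      RationalLink.extWt irα = -RationalLink.extWt α ∧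
      RationalLink.extWt rα = RationalLink.extWt α) ∧
    (Even q → Even x →
      RationalLink.extWt iα = -RationalLink.extWtPM α ∧
      RationalLink.extWt irα = -RationalLink.extWtPM α ∧
      RationalLink.extWt rα = RationalLink.extWt α) ∧
    (Even q → Even y →
      RationalLink.extWt iα = -RationalLink.extWtPM α ∧
      RationalLink.extWt irα = -RationalLink.extWt α ∧
      RationalLink.extWt rα = RationalLink.extWtPM α) := by
  open RationalLink Pairing in
  obtain ⟨w, h_p, h_q, hx, hy, h_r, h_s⟩ := exists_word_of_isParents hp hpq hcop hpar
  have hαw : α = frac w := by rw [hα, h_p, h_q]; rfl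
  have hiw : iα = frac (w.map not) := by rw [hi, frac_map_not, h_p, h_q]; push_cast; ring
  have hrw : rα = frac w.reverse := by rw [hr, frac_reverse, h_r, h_q]; push_cast; ring
  have hirw : irα = frac (w.reverse.map not) := by
    rw [hir, frac_map_not_reverse, h_s, h_q]; push_cast; ring
  rw [hαw, hiw, hrw, hirw]
  have hev : ∀ {S}, Even q → S ≠ se → run w S ≠ se := fun {S} hq hS h =>
    hS (run_se_of_even (by rw [h_q] at hq; exact_mod_cast hq) S h)
  refine ⟨fun hq => ?_, fun hq hxe => ?_, fun hq hye => ?_⟩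
  · have hw : run w se ≠ se := run_se_ne_of_odd (by rw [h_q] at hq; exact_mod_cast hq)
    exact ⟨extWt_map_not_of_run_se hw,
      by rw [extWt_map_not_of_run_se (run_reverse_se_ne hw), extWt_reverse_of_run_se hw],
      extWt_reverse_of_run_se hw⟩
  · have hsw : run w sw = sw := run_sw_of_even_right (by rw [h_q] at hq; exact_mod_cast hq)
      (by rw [hx] at hxe; exact_mod_cast hxe)
    have hne : run w ne = ne := by
      have h1 := hev hq (S := ne) (by decide)
      have h2 : run w ne ≠ run w sw := (run_injective w).ne (by decide)
      rw [hsw] at h2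
      cases h : run w ne <;> simp_all
    -- Both orientations are fixed by `run w`, so reversal preserves each of them.
    have rsw := run_reverse w sw
    have rne := run_reverse w ne
    have dsw := defect_reverse w sw
    have dne := defect_reverse w ne
    rw [hsw] at rsw dsw
    rw [hne] at rne dne
    refine ⟨extWt_map_not_of_even (by simp [hne]), ?_, ?_⟩
    · rw [extWt_map_not_of_even (by simp [rne]), extWtPM_frac (by simp [rne]),
        extWtPM_frac (by simp [hne]), dne]
    · rw [extWt_frac (by simp [rsw]), extWt_frac (by simp [hsw]), dsw]
  · have hsw : run w sw = ne := run_sw_of_even_left (by rw [h_q] at hq; exact_mod_cast hq)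
      (by rw [hy] at hye; exact_mod_cast hye)
    have hne : run w ne = sw := by
      have h1 := hev hq (S := ne) (by decide)
      have h2 : run w ne ≠ run w sw := (run_injective w).ne (by decide)
      rw [hsw] at h2
      cases h : run w ne <;> simp_all
    -- Here `run w` exchanges the two orientations, so reversal carries the defect at `sw` to that
    -- at `ne` and conversely.
    have rsw := run_reverse w sw
    have rne := run_reverse w ne
    have dsw := defect_reverse w sw
    have dne := defect_reverse w ne
    rw [hsw] at rsw dsw
    rw [hne] at rne dne
    refine ⟨extWt_map_not_of_even (by simp [hne]), ?_, ?_⟩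
    · rw [extWt_map_not_of_even (by simp [rsw]), extWtPM_frac (by simp [rsw]),
        extWt_frac (by simp [hsw]), dsw]
    · rw [extWt_frac (by simp [rne]), extWtPM_frac (by simp [hne]), dne]
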